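/- Conventions. Let $\Phi$ be a finite, reduced, crystallographic, irreducible root system spanning a real vector space $V$, with simple roots $\alpha_1,\dots,\alpha_\ell$ and pairing $(\cdot,\alpha^\vee)$ with the coroots. Its Cartan matrix is $C=(c_{ij})$, $c_{ij}=(\alpha_i,\alpha_j^\vee)$. The fundamental weights $\lambda_1,\dots,\lambda_\ell$ are given by $(\lambda_i,\alpha_j^\vee)=\delta_{ij}$; we identify $\mathbb Z^\ell$ with the weight lattice $P(\Phi)=\{x\in V:(x,\alpha^\vee)\in\mathbb Z\ \forall\alpha\in\Phi\}$ via $v\mapsto\sum_i v_i\lambda_i$. A weight $\lambda\in P(\Phi)$ is *dominant* if $(\lambda,\alpha_i^\vee)\ge 0$ for all $i$, and *minuscule* if $(\lambda,\alpha^\vee)\in\{-1,0,1\}$ for all $\alpha\in\Phi$. The Weyl vector $\varrho$ is half the sum of the positive roots. Let $C\in\mathbb Z^{\ell\times\ell}$ be a $Z$-matrix, i.e. $c_{ij}\le 0$ for $i\ne j$. A configuration $v\in\mathbb N^\ell$ is *stable* if $v_i<c_{ii}$ for all $i$; if $v_i\ge c_{ii}$, *toppling* at $i$ subtracts the $i$-th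 row of $C$ from $v$. The matrix $C$ is *avalanche-finite* if every $v\in\mathbb N^\ell$ can be brought to a stable configuration, written $\mathsf{stab}_C(v)$, by finitely many such topplings. A vector $v\in\mathbb Z^\ell$ is *recurrent* if $v=\mathsf{stab}_C(v+p)$ for some $p\in\mathbb N^\ell$ with all $p_i>0$. A configuration $u\in\mathbb N^\ell$ is *superstable* if $z\in\mathbb N^\ell$ and $u-C^tz\in\mathbb N^\ell$ together imply $z=\mathbf 0$. **Theorem 1.1.** Let $C$ be the Cartan matrix of a finite, reduced, crystallographic, irreducible root system $\Phi$, relative to a choice of simple roots. Then $C$ is avalanche-finite, every nonzero minuscule dominant weight is one of the fundamental weights $\lambda_i$, and under the identification $\mathbb Z^\ell\cong P(\Phi)$: (i) the superstable configurations for $C$ are exactly $\mathbf 0$ and the minuscule dominant weights $\lambda$; (ii) the recurrent configurations for $C$ are exactly $\varrho=(1,\dots,1)$ and $\varrho-\lambda$ for all minuscule dominant weights $\lambda$. -/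

import Mathlib

/-! ### Chip firing for integer matrices

Integer vectors are functions `I → ℤ` on a finite index type `I`; chip configurations are the
vectors `v` with `0 ≤ v` (componentwise). -/

namespace ChipFiring

variable {I : Type*}

/-- A `Z`-matrix: all off-diagonal entries are nonpositive. -/
def IsZMatrix (C : Matrix I I ℤ) : Prop :=
  ∀ i j, i ≠ j → C i j ≤ 0

/-- A nonnegative configuration `v` is stable if `v i < C i i` for every `i`. -/
def IsStable (C : Matrix I I ℤ) (v : I → ℤ) : Prop :=
  0 ≤ v ∧ ∀ i, v i < C i i

/-- `w` arises from the nonnegative configuration `v` by one valid toppling: at some state `i`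
with `C i i ≤ v i` the `i`-th row of `C` is subtracted from `v`. -/
def Topples (C : Matrix I I ℤ) (v w : I → ℤ) : Prop :=
  0 ≤ v ∧ ∃ i, C i i ≤ v i ∧ ∀ j, w j = v j - C i j

/-- `w` is a stabilization of `v`: it is stable and is reached from `v` by a finite
(possibly empty) sequence of valid topplings. -/
def IsStabilization (C : Matrix I I ℤ) (v w : I → ℤ) : Prop :=
  Relation.ReflTransGen (Topples C) v w ∧ IsStable C w

/-- A `Z`-matrix is avalanche-finite if every nonnegative configuration can be brought to a stable
one by a sequence of valid topplings. -/
def IsAvalancheFinite (C : Matrix I I ℤ) : Prop :=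
  IsZMatrix C ∧ ∀ v : I → ℤ, 0 ≤ v → ∃ w, IsStabilization C v w

/-- `v` is recurrent if `v` is the stabilization of `v + p` for some strictly positive `p`. -/
def IsRecurrent (C : Matrix I I ℤ) (v : I → ℤ) : Prop :=
  ∃ p : I → ℤ, (∀ i, 0 < p i) ∧ IsStabilization C (v + p) v

/-- `u ∈ ℕ^I` is superstable if `z ∈ ℕ^I` and `u - Cᵀ z ∈ ℕ^I` together force `z = 0`. -/
def IsSuperstable [Fintype I] (C : Matrix I I ℤ) (u : I → ℤ) : Prop :=
  0 ≤ u ∧ ∀ z : I → ℤ, 0 ≤ z → 0 ≤ u - C.transpose.mulVec z → z = 0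

end ChipFiring

/-! ### Weights of a root system -/

namespace RootWeights

variable {ι V V' : Type*} [AddCommGroup V] [Module ℝ V] [AddCommGroup V'] [Module ℝ V']
  {P : RootPairing ι ℝ V V'}

/-- The weight lattice: vectors whose pairing with every coroot is an integer. -/
def weightLattice (P : RootPairing ι ℝ V V') : Set V :=
  {x | ∀ i : ι, ∃ n : ℤ, P.toLinearMap x (P.coroot i) = n}

/-- Dominant weights, relative to the simple roots given by the base `b`. -/
def IsDominantWeight (b : P.Base) (x : V) : Prop :=
  x ∈ weightLattice P ∧ ∀ i ∈ b.support, 0 ≤ P.toLinearMap x (P.coroot i)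

/-- Minuscule weights: weights whose pairing with every coroot lies in `{-1, 0, 1}`. -/
def IsMinusculeWeight (P : RootPairing ι ℝ V V') (x : V) : Prop :=
  x ∈ weightLattice P ∧ ∀ i : ι, P.toLinearMap x (P.coroot i) ∈ ({-1, 0, 1} : Set ℝ)

/-- The weights that are both minuscule and dominant. -/
def minusculeDominantWeights (b : P.Base) : Set V :=
  {x | IsMinusculeWeight P x ∧ IsDominantWeight b x}

/-- The fundamental weights: the basis of `V` dual to the basis of simple coroots. -/
noncomputable def fundamentalWeight [P.IsRootSystem] (b : P.Base) (i : b.support) : V :=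
  P.toPerfPair.symm (b.toCoweightBasis.coord i)

open Classical in
/-- The defining duality between fundamental weights and simple coroots. -/
theorem fundamentalWeight_coroot [P.IsRootSystem] (b : P.Base) (i j : b.support) :
    P.toLinearMap (fundamentalWeight b i) (P.coroot j) = if j = i then 1 else 0 := by
  have h : P.toLinearMap (fundamentalWeight b i) = b.toCoweightBasis.coord i :=
    P.toPerfPair.apply_symm_apply (b.toCoweightBasis.coord i)
  rw [h, ← b.toCoweightBasis_apply j, Module.Basis.coord_apply, Module.Basis.repr_self,
    Finsupp.single_apply]

/-- The identification of integer vectors with weights, `v ↦ ∑ v i • λ i`, where the `λ i` are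
the fundamental weights. -/
noncomputable def toWeight [P.IsRootSystem] (b : P.Base) (v : b.support → ℤ) : V :=
  ∑ i, v i • fundamentalWeight b i

/-- The inverse identification recovers the coordinates by pairing with the simple coroots. -/
theorem toWeight_coroot [P.IsRootSystem] (b : P.Base) (v : b.support → ℤ) (j : b.support) :
    P.toLinearMap (toWeight b v) (P.coroot j) = v j := by
  simp [toWeight, fundamentalWeight_coroot]

/-- A root is positive if it is a combination of simple roots with coefficients in `ℕ`. -/
def IsPositive (b : P.Base) (i : ι) : Prop :=
  P.root i ∈ AddSubmonoid.closure (P.root '' b.support)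

open Classical in
/-- The Weyl vector: half the sum of the positive roots. -/
noncomputable def weylVector [Fintype ι] (b : P.Base) : V :=
  (1 / 2 : ℝ) • ∑ i with IsPositive b i, P.root i

end RootWeights

/-! ### Chip firing: scripts, least action and recurrence -/

namespace ChipFiring

open Matrix

variable {I : Type*} {C : Matrix I I ℤ}

/-! Row `i` of the Cartan matrix lists the coordinates of the simple root `α_i` in the fundamental
weights, so subtracting `Cᵀ z` from a configuration subtracts `∑ z_i α_i` from a weight. Superstable
configurations are therefore the dominant weights that are minimal in the dominance order, and these
are the minuscule ones. If a dominant weight pairs to at least 2 with some positive coroot, then a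
positive root can be subtracted from it inside the dominant chamber (`exists_isPos_sub_dominant`).
Conversely, a nonzero sum of positive roots pairs to at least 2 with some positive coroot
(`exists_isPos_two_le`), so it cannot be subtracted from a minuscule weight with dominant result.

Recurrence is dual to superstability by the least action principle (`exists_least_script`,
`isRecurrent_iff_isSuperstable`). The diagonal entries are 2, so the duality is `v ↦ 1 - v`, that is
`x ↦ ϱ - x`. The positive script it needs, which also gives avalanche-finiteness, is the coefficient
vector of `2ϱ`. Finally, some coroot involves every simple coroot; pairing with it leaves a nonzero
minuscule dominant weight a single coordinate, equal to 1. -/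

theorem Topples.nonneg (hC : IsZMatrix C) {v w : I → ℤ} (h : Topples C v w) : 0 ≤ w := by
  obtain ⟨hv, i, hi, hw⟩ := h
  intro j
  have hj := hv j
  rcases eq_or_ne i j with rfl | hij
  · simpa [hw] using hi
  · have := hC i j hij
    simp only [Pi.zero_apply, hw] at hj ⊢
    lia

theorem Topples.add_nonneg {v w q : I → ℤ} (h : Topples C v w) (hq : 0 ≤ q) :
    Topples C (v + q) (w + q) := by
  obtain ⟨hv, i, hi, hw⟩ := h
  refine ⟨_root_.add_nonneg hv hq, i, ?_, fun j ↦ ?_⟩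
  · have := hq i
    simp only [Pi.zero_apply, Pi.add_apply] at this ⊢
    lia
  · simp only [Pi.add_apply, hw]
    ring

theorem reflTransGen_add_nonneg {v w q : I → ℤ} (h : Relation.ReflTransGen (Topples C) v w)
    (hq : 0 ≤ q) : Relation.ReflTransGen (Topples C) (v + q) (w + q) :=
  h.lift (· + q) fun _ _ h ↦ h.add_nonneg hq

theorem reflTransGen_add_nsmul {v p : I → ℤ} (h : Relation.ReflTransGen (Topples C) (v + p) v)
    (hp : 0 ≤ p) (n : ℕ) : Relation.ReflTransGen (Topples C) (v + n • p) v := by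
  induction n with
  | zero => simpa using Relation.ReflTransGen.refl
  | succ n ih =>
    have := reflTransGen_add_nonneg h (nsmul_nonneg hp n)
    rw [add_assoc, ← succ_nsmul'] at this
    exact this.trans ih

theorem sub_single_nonneg [DecidableEq I] {y : I → ℤ} (hy : 0 ≤ y) {i : I} (hi : 1 ≤ y i) :
    0 ≤ y - Pi.single i 1 := by
  intro j
  have := hy j
  rcases eq_or_ne j i with rfl | hj <;> simp_all

variable [Fintype I]

theorem transpose_mulVec_nonpos (hC : IsZMatrix C) {y : I → ℤ} (hy : 0 ≤ y) {i : I}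
    (hi : y i = 0) : (Cᵀ *ᵥ y) i ≤ 0 := by
  refine Finset.sum_nonpos fun j _ ↦ ?_
  rcases eq_or_ne j i with rfl | hj
  · simp [hi]
  · exact mul_nonpos_of_nonpos_of_nonneg (hC j i hj) (hy j)

/-- Any nonnegative script carrying a configuration below the stability threshold topples every
unstable state. -/
theorem one_le_of_le_of_script (hC : IsZMatrix C) {a y : I → ℤ} (hy : 0 ≤ y) {i : I}
    (hi : C i i ≤ a i) (h : (a - Cᵀ *ᵥ y) i < C i i) : 1 ≤ y i := by
  by_contra! hlt
  have := transpose_mulVec_nonpos hC hy (i := i) (le_antisymm (by lia) (hy i))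
  simp only [Pi.sub_apply] at h
  lia

variable [DecidableEq I]

/-- Bookkeeping for inductions on scripts: one toppling at `i` uses up one unit of `y i` and leaves
the final configuration unchanged. -/
theorem Topples.sub_script {a c y : I → ℤ} {i : I} (h : ∀ j, c j = a j - C i j) :
    c - Cᵀ *ᵥ (y - Pi.single i 1) = a - Cᵀ *ᵥ y := by
  ext j
  simp [mulVec_sub, h]

/-- The least action principle: a sequence of valid topplings has a script which is a lower bound
for all nonnegative scripts carrying the initial configuration below the stability threshold. -/
theorem exists_least_script (hC : IsZMatrix C) {a c : I → ℤ}
    (h : Relation.ReflTransGen (Topples C) a c) :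
    ∃ x : I → ℤ, 0 ≤ x ∧ c = a - Cᵀ *ᵥ x ∧
      ∀ y : I → ℤ, 0 ≤ y → (∀ i, (a - Cᵀ *ᵥ y) i < C i i) → x ≤ y := by
  induction h using Relation.ReflTransGen.head_induction_on with
  | refl => exact ⟨0, le_rfl, by simp, fun y hy _ ↦ hy⟩
  | head h _ ih =>
    obtain ⟨x, hx, hc, hmin⟩ := ih
    obtain ⟨-, i, hi, hw⟩ := h
    refine ⟨x + Pi.single i 1, add_nonneg hx (by simp), ?_, fun y hy hst ↦ ?_⟩
    · rw [hc, ← Topples.sub_script hw, add_sub_cancel_right]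
    · rw [← le_sub_iff_add_le]
      refine hmin _ (sub_single_nonneg hy (one_le_of_le_of_script hC hy hi (hst i))) ?_
      rwa [Topples.sub_script hw]

/-- Induction on the total size of the script: an unstable state has `1 ≤ y i`, so toppling it
shortens the script. The script itself need not be a legal sequence of topplings. -/
theorem exists_isStabilization_of_script (hC : IsZMatrix C) {a y : I → ℤ} (ha : 0 ≤ a)
    (hy : 0 ≤ y) (hst : ∀ i, (a - Cᵀ *ᵥ y) i < C i i) : ∃ w, IsStabilization C a w := by
  induction hn : (∑ i, y i).toNat using Nat.strong_induction_on generalizing a y with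
  | _ n ih =>
    by_cases hs : ∀ i, a i < C i i
    · exact ⟨a, .refl, ha, hs⟩
    push Not at hs
    obtain ⟨i, hi⟩ := hs
    have h1 := one_le_of_le_of_script hC hy hi (hst i)
    have ht : Topples C a (fun j ↦ a j - C i j) := ⟨ha, i, hi, fun _ ↦ rfl⟩
    have hle : y i ≤ ∑ j, y j := Finset.single_le_sum (fun j _ ↦ hy j) (Finset.mem_univ i)
    have hlt : (∑ j, (y - Pi.single i 1 : I → ℤ) j).toNat < n := by
      simp only [Pi.sub_apply, Finset.sum_sub_distrib, Finset.sum_pi_single', Finset.mem_univ,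
        if_true]
      lia
    obtain ⟨w, hw, hws⟩ := ih _ hlt (ht.nonneg hC) (sub_single_nonneg hy h1)
      (by rwa [Topples.sub_script fun _ ↦ rfl]) rfl
    exact ⟨w, hw.head ht, hws⟩

theorem isAvalancheFinite_of_script (hC : IsZMatrix C) (hd : ∀ i, 0 < C i i) {y : I → ℤ}
    (hy : 0 ≤ y) (hpos : ∀ i, 0 < (Cᵀ *ᵥ y) i) : IsAvalancheFinite C := by
  refine ⟨hC, fun v hv ↦ ?_⟩
  -- By integrality `Cᵀ y ≥ 1` in each coordinate, so `∑ v` copies of `y` push every coordinate of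
  -- `v` to at most 0, below the positive diagonal.
  refine exists_isStabilization_of_script hC hv (smul_nonneg (Finset.sum_nonneg fun i _ ↦ hv i) hy)
    (y := (∑ i, v i) • y) fun i ↦ ?_
  have hle : v i ≤ ∑ j, v j := Finset.single_le_sum (fun j _ ↦ hv j) (Finset.mem_univ i)
  have h0 := hv i
  have := hpos i
  have := hd i
  simp only [mulVec_smul, Pi.sub_apply, Pi.smul_apply, smul_eq_mul, Pi.zero_apply] at *
  nlinarith

theorem IsSuperstable.lt_diag {u : I → ℤ} (hC : IsZMatrix C) (hu : IsSuperstable C u) (i : I) :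
    u i < C i i := by
  by_contra! hi
  have h := hu.2 (Pi.single i 1) (by simp) fun j ↦ by
    have := hu.1 j
    rcases eq_or_ne i j with rfl | hij
    · simpa using hi
    · have := hC i j hij
      simp_all
      lia
  simpa using congr_fun h i

/-- Recurrent and superstable configurations are exchanged by complementation in the maximal
stable configuration. -/
theorem isRecurrent_iff_isSuperstable (hC : IsZMatrix C) (hd : ∀ i, 0 < C i i)
    (hinj : Function.Injective (Cᵀ *ᵥ ·)) {y : I → ℤ} (hy : 0 ≤ y)
    (hpos : ∀ i, 0 < (Cᵀ *ᵥ y) i) (v : I → ℤ) :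
    IsRecurrent C v ↔ IsSuperstable C (fun i ↦ C i i - 1 - v i) := by
  constructor
  · rintro ⟨p, hp, hreach, hv, hlt⟩
    have hp0 : 0 ≤ p := fun i ↦ (hp i).le
    refine ⟨fun i ↦ by have := hlt i; simp only [Pi.zero_apply]; lia, fun z hz hzu ↦ ?_⟩
    obtain ⟨x, hx, hvx, -⟩ := exists_least_script hC hreach
    have hpx : Cᵀ *ᵥ x = p := by
      ext i
      have := congr_fun hvx i
      simp only [Pi.sub_apply, Pi.add_apply] at this
      lia
    have hx1 (i : I) : 1 ≤ x i := by
      by_contra! hlt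
      have := transpose_mulVec_nonpos hC hx (i := i) (le_antisymm (by lia) (hx i))
      rw [hpx] at this
      exact absurd (hp i) (by lia)
    -- Since `x ≥ 1` everywhere, `n • x - z` is nonnegative. It carries `v + n • p` to `v + Cᵀ z`,
    -- which is still below the threshold, while the least script is `n • x`; hence `z ≤ 0`.
    set n : ℕ := (∑ i, z i).toNat with hn
    have hnz (i : I) : z i ≤ n := by
      have hle : z i ≤ ∑ j, z j := Finset.single_le_sum (fun j _ ↦ hz j) (Finset.mem_univ i)
      lia
    obtain ⟨x', -, hvx', hmin⟩ := exists_least_script hC (reflTransGen_add_nsmul hreach hp0 n)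
    have hxx' : x' = n • x := hinj <| by
      ext i
      have := congr_fun hvx' i
      simp only [Pi.sub_apply, Pi.add_apply, mulVec_smul, hpx] at this ⊢
      lia
    have hle := hmin (n • x - z)
      (fun i ↦ by
        have h1 := hx1 i
        have h2 := hnz i
        simp only [Pi.zero_apply, Pi.sub_apply, Pi.smul_apply]
        rw [nsmul_eq_mul]
        nlinarith [hz i])
      (fun i ↦ by
        have := hzu i
        simp only [mulVec_sub, mulVec_smul, hpx, Pi.zero_apply, Pi.sub_apply, Pi.add_apply]
          at this ⊢
        lia)
    rw [hxx', le_sub_self_iff] at hle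
    exact le_antisymm hle hz
  · intro hu
    have hv : 0 ≤ v := fun i ↦ by
      have := hu.lt_diag hC i
      simp only [Pi.zero_apply]
      lia
    have hlt (i : I) : v i < C i i := by
      have := hu.1 i
      simp only [Pi.zero_apply] at this
      lia
    refine ⟨Cᵀ *ᵥ y, hpos, ?_⟩
    obtain ⟨w, hw, hws⟩ := (isAvalancheFinite_of_script hC hd hy hpos).2 (v + Cᵀ *ᵥ y)
      (add_nonneg hv fun i ↦ (hpos i).le)
    obtain ⟨x, hx, hwx, hmin⟩ := exists_least_script hC hw
    have hxy := hmin y hy (by simpa using hlt)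
    -- The complement of `v`, minus `Cᵀ (y - x)`, is the complement of the stable `w`, hence
    -- nonnegative; superstability then forces `x = y`, so `w = v`.
    have hyx := hu.2 (y - x) (sub_nonneg.mpr hxy) fun i ↦ by
      have h1 := congr_fun hwx i
      have h2 := hws.2 i
      simp only [Pi.sub_apply, Pi.add_apply, Pi.zero_apply, mulVec_sub] at h1 ⊢
      lia
    rw [sub_eq_zero] at hyx
    rw [← hyx, add_sub_cancel_right] at hwx
    subst hwx
    exact ⟨hw, hws⟩

end ChipFiring

/-! ### Invariant form, integrality and positive roots -/

namespace RootWeights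

open Function Set Matrix

variable {ι V V' : Type*} [AddCommGroup V] [Module ℝ V] [AddCommGroup V'] [Module ℝ V']
  {P : RootPairing ι ℝ V V'}

/-- Invariance under the reflection in root `i`, which negates that root. This transfers signs
between the form and the pairing with coroots. -/
theorem two_mul_form_root (B : P.InvariantForm) (x : V) (i : ι) :
    2 * B.form x (P.root i) = P.toLinearMap x (P.coroot i) * B.form (P.root i) (P.root i) := by
  have h := B.apply_reflection_reflection i x (P.root i)
  simp only [P.reflection_apply_self, P.reflection_apply, map_neg, map_sub, map_smul,
    LinearMap.sub_apply, LinearMap.smul_apply, smul_eq_mul] at h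
  simp only [RootPairing.coroot', LinearMap.flip_apply] at h
  linarith

theorem exists_int_pairing_coroot (b : P.Base) {x : V}
    (hx : ∀ i ∈ b.support, ∃ n : ℤ, P.toLinearMap x (P.coroot i) = n) (i : ι) :
    ∃ n : ℤ, P.toLinearMap x (P.coroot i) = n := by
  have hi := b.coroot_mem_span_int i
  generalize P.coroot i = y at hi
  induction hi using Submodule.span_induction with
  | mem y hy =>
    obtain ⟨j, hj, rfl⟩ := hy
    exact hx j hj
  | zero => exact ⟨0, by simp⟩
  | add y z _ _ hy hz =>
    obtain ⟨⟨m, hm⟩, ⟨n, hn⟩⟩ := And.intro hy hz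
    exact ⟨m + n, by simp [hm, hn]⟩
  | smul k y _ hy =>
    obtain ⟨m, hm⟩ := hy
    exact ⟨k * m, by simp [hm]⟩

theorem root_ne_neg_of_isPos {b : P.Base} {i j : ι} (hi : b.IsPos i) (hj : b.IsPos j) :
    P.root i ≠ -P.root j := by
  let := P.indexNeg
  intro h
  have : i = -j := P.root.injective (by simpa using h)
  rw [this, RootPairing.Base.IsPos.neg_iff_not] at hi
  exact hi hj

/-- Coefficients in `ℕ` make the height nonnegative, and this already characterizes positive roots.
-/
theorem isPos_of_mem_closure {b : P.Base} {i : ι} (h : P.root i ∈ AddSubmonoid.closure (P.root '' b.support)) :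
    b.IsPos i := by
  classical
  rw [← Submodule.span_nat_eq_addSubmonoidClosure, Submodule.mem_toAddSubmonoid] at h
  obtain ⟨f, hf⟩ := (Submodule.mem_span_image_finset_iff_exists_fun ℕ).mp h
  let g : ι → ℤ := fun j ↦ if hj : j ∈ b.support then f ⟨j, hj⟩ else 0
  have hg : P.root i = ∑ j ∈ b.support, g j • P.root j := by
    rw [← hf, ← Finset.sum_coe_sort b.support]
    simp [g]
  rw [RootPairing.Base.isPos_iff', RootPairing.Base.height_eq_sum hg]
  refine Finset.sum_nonneg fun j hj ↦ ?_
  simp [g, hj]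

theorem isPositive_iff_isPos {b : P.Base} {i : ι} : IsPositive b i ↔ b.IsPos i := by
  refine ⟨isPos_of_mem_closure, fun h ↦ (b.root_mem_or_neg_mem i).resolve_right fun hn ↦ ?_⟩
  let := P.indexNeg
  have : b.IsPos (-i) := isPos_of_mem_closure (by simpa using hn)
  exact (RootPairing.Base.IsPos.neg_iff_not b i).mp this h

theorem _root_.RootPairing.Base.IsPos.exists_nat {b : P.Base} {i : ι} (h : b.IsPos i) :
    ∃ f : b.support → ℕ, P.root i = ∑ j, f j • P.root j := by
  obtain ⟨f, hf⟩ := (Submodule.mem_span_image_finset_iff_exists_fun ℕ).mp <| by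
    simpa only [IsPositive, ← Submodule.span_nat_eq_addSubmonoidClosure,
      Submodule.mem_toAddSubmonoid] using isPositive_iff_isPos.mpr h
  exact ⟨f, hf.symm⟩

/-! ### Subtracting positive roots from dominant weights; roots of full support -/

section FiniteRootSystem

variable [Fintype ι] [P.IsCrystallographic] {b : P.Base}

/-- A nonzero sum of positive roots pairs to at least two with some positive coroot. -/
theorem exists_isPos_two_le {β : V} [P.IsRootSystem]
    (hβ : β ∈ AddSubmonoid.closure (P.root '' {i | b.IsPos i})) (h0 : β ≠ 0) :
    ∃ i, b.IsPos i ∧ 2 ≤ P.toLinearMap β (P.coroot i) := by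
  classical
  -- Below, `β` is written with the fewest possible positive roots.
  have hex : ∃ n, ∃ s : Multiset ι, s.card = n ∧ (∀ i ∈ s, b.IsPos i) ∧ (s.map P.root).sum = β := by
    induction hβ using AddSubmonoid.closure_induction with
    | mem x hx =>
      obtain ⟨i, hi, rfl⟩ := hx
      exact ⟨1, {i}, by simp, by simpa using hi, by simp⟩
    | zero => exact absurd rfl h0
    | add x y hx hy ihx ihy =>
      by_cases hx0 : x = 0
      · simpa [hx0] using ihy (by simpa [hx0] using h0)
      by_cases hy0 : y = 0
      · simpa [hy0] using ihx hx0
      obtain ⟨⟨_, s, -, hs, hsx⟩, ⟨_, t, -, ht, hty⟩⟩ := And.intro (ihx hx0) (ihy hy0)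
      refine ⟨_, s + t, rfl, fun i hi ↦ ?_, by simp [hsx, hty]⟩
      exact (Multiset.mem_add.mp hi).elim (hs i) (ht i)
  obtain ⟨s, hcard, hs, hsum⟩ := Nat.find_spec hex
  let B := P.toInvariantForm
  have hB (i : ι) : 0 < B.form (P.root i) (P.root i) :=
    P.rootForm_pos_of_ne_zero (by simp) (P.ne_zero i)
  have hββ : 0 < B.form β β := P.rootForm_pos_of_ne_zero (by simp) h0
  obtain ⟨k, hk, hkpos⟩ : ∃ k ∈ s, 0 < B.form β (P.root k) := by
    by_contra! hcon
    refine hββ.not_ge ?_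
    nth_rw 2 [← hsum]
    rw [map_multiset_sum, Multiset.map_map]
    rw [← neg_nonneg, ← Multiset.sum_map_neg']
    exact Multiset.sum_nonneg (by simpa using hcon)
  refine ⟨k, hs k hk, ?_⟩
  by_contra! hlt
  obtain ⟨t, rfl⟩ := Multiset.exists_cons_of_mem hk
  have hβk : P.toLinearMap β (P.coroot k) = 2 + (t.map fun j ↦ (P.pairingIn ℤ j k : ℝ)).sum := by
    rw [← hsum, ← LinearMap.flip_apply, map_multiset_sum, Multiset.map_map, Multiset.map_cons,
      Multiset.sum_cons]
    congr 1
    · simp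
    · congr 1
      refine Multiset.map_congr rfl fun j _ ↦ ?_
      simpa using (P.algebraMap_pairingIn ℤ j k).symm
  have hpos : 0 < P.toLinearMap β (P.coroot k) := by
    have := two_mul_form_root B β k
    have := hB k
    by_contra! hle
    nlinarith
  -- The summand `k` contributes 2, so a total below 2 needs a summand `j` pairing negatively with
  -- it. Then `j + k` is a positive root, and merging the two contradicts minimality.
  obtain ⟨j, hj, hjk⟩ : ∃ j ∈ t, P.pairingIn ℤ j k < 0 := by
    by_contra! hcon
    have : 0 ≤ (t.map fun j ↦ (P.pairingIn ℤ j k : ℝ)).sum :=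
      Multiset.sum_nonneg (by simpa using hcon)
    linarith
  obtain ⟨t, rfl⟩ := Multiset.exists_cons_of_mem hj
  simp only [Multiset.mem_cons, forall_eq_or_imp] at hs
  obtain ⟨l, hl⟩ := P.root_add_root_mem_of_pairingIn_neg hjk (root_ne_neg_of_isPos hs.2.1 hs.1)
  refine Nat.find_min hex (m := t.card + 1) ?_ ⟨l ::ₘ t, by simp, ?_, ?_⟩
  · rw [← hcard]
    simp
  · simp only [Multiset.mem_cons, forall_eq_or_imp]
    exact ⟨hs.2.1.add hs.1 hl, hs.2.2⟩
  · rw [← hsum]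
    simp only [Multiset.map_cons, Multiset.sum_cons, hl]
    abel

omit [P.IsCrystallographic] in
/-- Dominant vectors pair nonnegatively with positive coroots. -/
theorem pairing_nonneg_of_isPos [P.IsRootSystem] {x : V}
    (hx : ∀ i ∈ b.support, 0 ≤ P.toLinearMap x (P.coroot i)) {i : ι} (hi : b.IsPos i) :
    0 ≤ P.toLinearMap x (P.coroot i) := by
  let B := P.toInvariantForm
  have hB (i : ι) : 0 < B.form (P.root i) (P.root i) :=
    P.rootForm_pos_of_ne_zero (by simp) (P.ne_zero i)
  obtain ⟨f, hf⟩ := hi.exists_nat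
  have h : 0 ≤ B.form x (P.root i) := by
    rw [hf, map_sum]
    refine Finset.sum_nonneg fun ⟨j, hj⟩ _ ↦ ?_
    have := two_mul_form_root B x j
    have := mul_nonneg (hx j hj) (hB j).le
    rw [map_nsmul]
    exact nsmul_nonneg (by linarith) _
  have := two_mul_form_root B x i
  have := hB i
  by_contra! hlt
  nlinarith

/-- If a dominant weight pairs to at least two with some coroot, then a positive root may be
subtracted from it without leaving the dominant chamber. -/
theorem exists_isPos_sub_dominant [P.IsRootSystem] [P.IsReduced] {x : V}
    (hx : ∀ i ∈ b.support, ∃ n : ℕ, P.toLinearMap x (P.coroot i) = n)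
    {i : ι} (hi : b.IsPos i) (h2 : 2 ≤ P.toLinearMap x (P.coroot i)) :
    ∃ k, b.IsPos k ∧ ∀ j ∈ b.support, 0 ≤ P.toLinearMap (x - P.root k) (P.coroot j) := by
  let B := P.toInvariantForm
  have hB (i : ι) : 0 < B.form (P.root i) (P.root i) :=
    P.rootForm_pos_of_ne_zero (by simp) (P.ne_zero i)
  let S : Set ι := {k | b.IsPos k ∧ 2 ≤ P.toLinearMap x (P.coroot k)}
  -- A root of least height in `S` works: if subtracting it violates dominance at a simple root `j`,
  -- then `l = k - j` is a lower root that is again in `S`.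
  obtain ⟨k, ⟨hk, hk2⟩, hmin⟩ :=
    Set.exists_min_image S b.height (Set.toFinite S) ⟨i, hi, h2⟩
  refine ⟨k, hk, fun j hj ↦ ?_⟩
  by_contra! hneg
  obtain ⟨n, hn⟩ := hx j hj
  rw [map_sub, LinearMap.sub_apply, hn, P.root_coroot_eq_pairing, ← P.algebraMap_pairingIn ℤ,
    eq_intCast, sub_neg] at hneg
  have hlt : (n : ℤ) < P.pairingIn ℤ k j := by exact_mod_cast hneg
  rcases eq_or_ne k j with rfl | hkj
  · rw [hn] at hk2
    simp only [P.pairingIn_same] at hlt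
    have : 2 ≤ n := by exact_mod_cast hk2
    lia
  obtain ⟨l, hl⟩ := P.root_sub_root_mem_of_pairingIn_pos (i := k) (j := j) (by lia) hkj
  have hlpos : b.IsPos l := hk.sub hj hl
  have hht := b.height_sub hl
  rw [RootPairing.Base.height_one_of_mem_support hj] at hht
  suffices hl2 : 2 ≤ P.toLinearMap x (P.coroot l) by
    have := hmin l ⟨hlpos, hl2⟩
    lia
  have e1 := two_mul_form_root B x k
  have e2 := two_mul_form_root B x j
  have e3 := two_mul_form_root B x l
  have e4 := two_mul_form_root B (P.root k) j
  have e5 : B.form (P.root l) (P.root l) = B.form (P.root k) (P.root k) -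
      2 * B.form (P.root k) (P.root j) + B.form (P.root j) (P.root j) := by
    have := B.symm.eq (P.root k) (P.root j)
    simp only [RingHom.id_apply] at this
    simp only [hl, map_sub, LinearMap.sub_apply, this]
    ring
  have e6 : 2 * B.form x (P.root l) = 2 * B.form x (P.root k) - 2 * B.form x (P.root j) := by
    rw [hl, map_sub]
    ring
  rw [P.root_coroot_eq_pairing, ← P.algebraMap_pairingIn ℤ, eq_intCast] at e4
  rw [e3, e1, e2, hn] at e6
  have hle : (n : ℝ) + 1 ≤ P.pairingIn ℤ k j := by exact_mod_cast hlt
  have hBj := hB j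
  have hBl := hB l
  have hn0 : (0 : ℝ) ≤ n := n.cast_nonneg
  set m := P.toLinearMap x (P.coroot k)
  set q := B.form (P.root j) (P.root j)
  -- With `c` the pairing of `k` with the coroot of `j`, `|l|² = |k|² - (c - 1) q` and `2 (x, l) = m
  -- |k|² - n q`. Since `n ≤ c - 1` and `m ≥ 1`, the pairing of `x` with the coroot of `l` is at
  -- least `m`.
  have h3 : (n : ℝ) * q ≤ m * ((P.pairingIn ℤ k j - 1) * q) := by
    have h4 : (n : ℝ) * q ≤ (P.pairingIn ℤ k j - 1) * q := by gcongr; linarith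
    have h5 : 0 ≤ (n : ℝ) * q := by positivity
    nlinarith
  have h6 : m * B.form (P.root l) (P.root l) ≤
      P.toLinearMap x (P.coroot l) * B.form (P.root l) (P.root l) := by
    rw [e6, e5, e4]
    linarith
  exact hk2.trans (le_of_mul_le_mul_right h6 hBl)

/-- An irreducible root system has a root involving every simple root. -/
theorem exists_root_full_support [P.IsReduced] [P.IsIrreducible] [Nonempty ι] (b : P.Base) :
    ∃ i, ∃ f : b.support → ℕ, (∀ j, 0 < f j) ∧ P.root i = ∑ j, f j • P.root j := by
  obtain ⟨i, hmax⟩ := Finite.exists_max b.height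
  have hi : b.IsPos i := by
    obtain ⟨j, hj⟩ := b.support_nonempty
    have := hmax j
    rw [RootPairing.Base.height_one_of_mem_support hj] at this
    exact (RootPairing.Base.isPos_iff b).mpr (by lia)
  obtain ⟨f, hf'⟩ := hi.exists_nat
  refine ⟨i, f, fun j ↦ ?_, hf'⟩
  obtain ⟨j₀, hj₀⟩ : ∃ j : b.support, 0 < f j := by
    by_contra! hcon
    exact P.ne_zero i (by simpa [Nat.le_zero.mp (hcon _)] using hf')
  -- The support of a root of maximal height is closed under adjacency in the Dynkin diagram: an
  -- adjacent simple root `l` outside it would pair negatively, making `root i + root l` a higher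
  -- root.
  refine b.induction_on_cartanMatrix (fun j ↦ 0 < f j) hj₀ fun k l hk hlk ↦ ?_
  by_contra! hl
  have hne (t : b.support) (ht : 0 < f t) : t ≠ l := by rintro rfl; lia
  have hsum : P.pairingIn ℤ i l = ∑ t : b.support, f t * b.cartanMatrix t l := by
    have h : P.pairing i l = ∑ t : b.support, f t * P.pairing t l := by
      rw [← P.root_coroot_eq_pairing, hf', map_sum, LinearMap.sum_apply]
      simp
    have : ((P.pairingIn ℤ i l : ℤ) : ℝ) = ∑ t : b.support, f t * (b.cartanMatrix t l : ℝ) := by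
      simpa [RootPairing.Base.cartanMatrixIn_def, ← P.algebraMap_pairingIn ℤ] using h
    exact_mod_cast this
  have hneg : P.pairingIn ℤ i l < 0 := by
    rw [hsum]
    refine Finset.sum_neg' (fun t _ ↦ ?_) ⟨k, Finset.mem_univ k, ?_⟩
    · rcases (f t).eq_zero_or_pos with ht | ht
      · simp [ht]
      · exact mul_nonpos_of_nonneg_of_nonpos (by positivity)
          (b.cartanMatrix_le_zero_of_ne t l (hne t ht))
    · refine mul_neg_of_pos_of_neg (by exact_mod_cast hk) ?_
      refine lt_of_le_of_ne (b.cartanMatrix_le_zero_of_ne k l (hne k hk)) ?_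
      rwa [Ne, b.cartanMatrix_apply_eq_zero_iff_symm]
  obtain ⟨m, hm⟩ := P.root_add_root_mem_of_pairingIn_neg hneg
    (root_ne_neg_of_isPos hi (RootPairing.Base.isPos_of_mem_support l.2))
  have := hmax m
  rw [b.height_add hm, RootPairing.Base.height_one_of_mem_support l.2] at this
  lia

end FiniteRootSystem

/-! ### Integer vectors as weights -/

variable [P.IsRootSystem] {b : P.Base}

theorem ext_of_coroot (b : P.Base) {x y : V}
    (h : ∀ i ∈ b.support, P.toLinearMap x (P.coroot i) = P.toLinearMap y (P.coroot i)) :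
    x = y :=
  P.toPerfPair.injective <| b.toCoweightBasis.ext fun i ↦ by simpa using h i i.2

theorem toWeight_sub (u v : b.support → ℤ) :
    toWeight b (u - v) = toWeight b u - toWeight b v :=
  ext_of_coroot b fun i hi ↦ by simp [toWeight_coroot b _ ⟨i, hi⟩]

theorem toWeight_injective : Injective (toWeight b) := fun u v h ↦ by
  ext i
  have := toWeight_coroot b v i
  rw [← h, toWeight_coroot] at this
  exact_mod_cast this

theorem exists_toWeight_eq {x : V} (hx : x ∈ weightLattice P) : ∃ u, toWeight b u = x := by
  choose n hn using hx
  exact ⟨fun i ↦ n i, ext_of_coroot b fun i hi ↦ by simp [toWeight_coroot b _ ⟨i, hi⟩, hn]⟩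

theorem toWeight_mem_weightLattice (u : b.support → ℤ) : toWeight b u ∈ weightLattice P :=
  exists_int_pairing_coroot b fun i hi ↦ ⟨u ⟨i, hi⟩, toWeight_coroot b u ⟨i, hi⟩⟩

theorem isDominantWeight_toWeight_iff {u : b.support → ℤ} :
    IsDominantWeight b (toWeight b u) ↔ 0 ≤ u := by
  refine ⟨fun h i ↦ ?_, fun h ↦ ⟨toWeight_mem_weightLattice u, fun i hi ↦ ?_⟩⟩
  · have := h.2 i i.2
    rw [toWeight_coroot] at this
    exact_mod_cast this
  · rw [toWeight_coroot b u ⟨i, hi⟩]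
    exact_mod_cast h ⟨i, hi⟩

variable [P.IsCrystallographic]

theorem toWeight_transpose_cartanMatrix_mulVec (z : b.support → ℤ) :
    toWeight b (b.cartanMatrixᵀ *ᵥ z) = ∑ i, z i • P.root i :=
  ext_of_coroot b fun i hi ↦ by
    rw [toWeight_coroot b _ ⟨i, hi⟩]
    simp [mulVec, dotProduct, RootPairing.Base.cartanMatrixIn_def, ← P.algebraMap_pairingIn ℤ,
      mul_comm]

omit [P.IsRootSystem] in
theorem isZMatrix_cartanMatrix [Finite ι] (b : P.Base) : ChipFiring.IsZMatrix b.cartanMatrix :=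
  b.cartanMatrix_le_zero_of_ne

/-! ### Superstable configurations and minuscule weights -/

variable [Fintype ι]

theorem isSuperstable_of_isMinusculeWeight {u : b.support → ℤ} (hu : 0 ≤ u)
    (hm : IsMinusculeWeight P (toWeight b u)) : ChipFiring.IsSuperstable b.cartanMatrix u := by
  refine ⟨hu, fun z hz hzu ↦ ?_⟩
  by_contra hz0
  have hβ : ∑ i, z i • P.root i ∈ AddSubmonoid.closure (P.root '' {i | b.IsPos i}) := by
    refine sum_mem fun i _ ↦ ?_
    have hi : P.root i ∈ AddSubmonoid.closure (P.root '' {i | b.IsPos i}) :=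
      AddSubmonoid.subset_closure
        (mem_image_of_mem P.root (RootPairing.Base.isPos_of_mem_support i.2))
    obtain ⟨n, hn⟩ := Int.eq_ofNat_of_zero_le (hz i)
    rw [hn, natCast_zsmul]
    exact AddSubmonoid.nsmul_mem _ hi n
  have hβ0 : ∑ i, z i • P.root i ≠ 0 := fun h ↦ hz0 <| funext <|
    Fintype.linearIndependent_iff.mp (b.linearIndepOn_root.restrict_scalars' ℤ) z h
  obtain ⟨k, hk, hk2⟩ := exists_isPos_two_le hβ hβ0
  have h0 := pairing_nonneg_of_isPos (isDominantWeight_toWeight_iff.mpr hzu).2 hk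
  rw [toWeight_sub, toWeight_transpose_cartanMatrix_mulVec, map_sub, LinearMap.sub_apply] at h0
  have := hm.2 k
  simp only [mem_insert_iff, mem_singleton_iff] at this
  rcases this with h | h | h <;> linarith

variable [P.IsReduced]

theorem isMinusculeWeight_of_isSuperstable {u : b.support → ℤ}
    (hu : ChipFiring.IsSuperstable b.cartanMatrix u) : IsMinusculeWeight P (toWeight b u) := by
  refine ⟨toWeight_mem_weightLattice u, ?_⟩
  have hlt (i : ι) (hi : b.IsPos i) : P.toLinearMap (toWeight b u) (P.coroot i) < 2 := by
    by_contra! h2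
    have hnat (j) (hj : j ∈ b.support) :
        ∃ n : ℕ, P.toLinearMap (toWeight b u) (P.coroot j) = n := by
      refine ⟨(u ⟨j, hj⟩).toNat, ?_⟩
      rw [toWeight_coroot b u ⟨j, hj⟩]
      exact_mod_cast (Int.toNat_of_nonneg (hu.1 _)).symm
    obtain ⟨k, hk, hdom⟩ := exists_isPos_sub_dominant hnat hi h2
    obtain ⟨f, hf⟩ := hk.exists_nat
    -- The simple-root coefficients of `k` form a script that superstability forces to vanish,
    -- although a root is nonzero.
    have hroot : P.root k = toWeight b (b.cartanMatrixᵀ *ᵥ fun i ↦ (f i : ℤ)) := by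
      rw [toWeight_transpose_cartanMatrix_mulVec, hf]
      simp
    rw [hroot, ← toWeight_sub] at hdom
    have h0 := hu.2 _ (fun i ↦ by positivity)
      (isDominantWeight_toWeight_iff.mp ⟨toWeight_mem_weightLattice _, hdom⟩)
    refine P.ne_zero k ?_
    rw [hroot, h0]
    simp [toWeight]
  have hmem (i : ι) (hi : b.IsPos i) : P.toLinearMap (toWeight b u) (P.coroot i) = 0 ∨
      P.toLinearMap (toWeight b u) (P.coroot i) = 1 := by
    obtain ⟨n, hn⟩ := toWeight_mem_weightLattice u i
    have h1 := hlt i hi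
    have h2 := pairing_nonneg_of_isPos (isDominantWeight_toWeight_iff.mpr hu.1).2 hi
    rw [hn] at h1 h2 ⊢
    norm_cast at h1 h2 ⊢
    lia
  intro i
  let := P.indexNeg
  rcases RootPairing.Base.IsPos.or_neg b i with hi | hi
  · rcases hmem i hi with h | h <;> simp [h]
  · have := hmem (-i) hi
    simp only [RootPairing.indexNeg_neg, RootPairing.coroot_reflectionPerm,
      RootPairing.coreflection_apply_self, map_neg, neg_eq_iff_eq_neg] at this
    rcases this with h | h <;> simp [h]

/-! ### The Weyl vector and the fundamental weights -/

omit [P.IsRootSystem] in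
-- The simple reflection at `j` permutes the positive roots other than `j` and negates their pairing
-- with the coroot of `j`. Their contributions cancel, leaving half of 2.
theorem weylVector_coroot {j : ι} (hj : j ∈ b.support) :
    P.toLinearMap (weylVector b) (P.coroot j) = 1 := by
  classical
  have hne (i : ι) (hi : b.IsPos i) : P.reflectionPerm j i ≠ j := by
    intro h
    refine root_ne_neg_of_isPos hi (RootPairing.Base.isPos_of_mem_support hj) ?_
    rw [← P.reflection_apply_self j, ← P.root_reflectionPerm]
    congr 1
    rw [← P.reflectionPerm_self j i, h]
  have hsum : ∑ i with b.IsPos i ∧ i ≠ j, P.pairing i j = 0 := by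
    have h : ∑ i with b.IsPos i ∧ i ≠ j, P.pairing i j =
        ∑ i with b.IsPos i ∧ i ≠ j, -P.pairing i j := by
      refine Finset.sum_nbij' (P.reflectionPerm j) (P.reflectionPerm j) ?_ ?_ ?_ ?_ ?_
      all_goals simp only [Finset.mem_filter, Finset.mem_univ, true_and]
      · exact fun i hi ↦ ⟨hi.1.reflectionPerm hj hi.2, hne i hi.1⟩
      · exact fun i hi ↦ ⟨hi.1.reflectionPerm hj hi.2, hne i hi.1⟩
      · simp
      · simp
      · intro i _
        rw [← P.pairing_reflectionPerm, P.pairing_reflectionPerm_self_right, neg_neg]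
    rw [Finset.sum_neg_distrib] at h
    linarith
  have hfilter : (Finset.univ.filter fun i ↦ IsPositive b i) =
      insert j (Finset.univ.filter fun i ↦ b.IsPos i ∧ i ≠ j) := by
    ext i
    rcases eq_or_ne i j with rfl | hij
    · simp [isPositive_iff_isPos, RootPairing.Base.isPos_of_mem_support hj]
    · simp [isPositive_iff_isPos, hij]
  simp only [weylVector, map_smul, map_sum, LinearMap.smul_apply, LinearMap.sum_apply,
    P.root_coroot_eq_pairing, smul_eq_mul]
  convert_to (1 / 2 : ℝ) * ∑ i with IsPositive b i, P.pairing i j = 1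
  rw [hfilter, Finset.sum_insert (by simp), hsum]
  simp

theorem toWeight_one : toWeight b 1 = weylVector b :=
  ext_of_coroot b fun i hi ↦ by
    rw [toWeight_coroot b 1 ⟨i, hi⟩, weylVector_coroot hi]
    simp

/-- Twice the Weyl vector is a nonnegative integral combination of simple roots. -/
theorem exists_transpose_cartanMatrix_mulVec_eq_two (b : P.Base) :
    ∃ y : b.support → ℤ, 0 ≤ y ∧ b.cartanMatrixᵀ *ᵥ y = 2 := by
  classical
  choose! f hf using fun i (hi : b.IsPos i) ↦ hi.exists_nat
  refine ⟨fun j ↦ ∑ i with b.IsPos i, (f i j : ℤ), fun j ↦ by positivity, ?_⟩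
  refine toWeight_injective (b := b) ?_
  have h2 : toWeight b 2 = (2 : ℝ) • toWeight b 1 :=
    ext_of_coroot b fun i hi ↦ by simp [toWeight_coroot b _ ⟨i, hi⟩]
  rw [h2, toWeight_one, toWeight_transpose_cartanMatrix_mulVec, weylVector, smul_smul]
  simp only [Finset.sum_smul, isPositive_iff_isPos]
  rw [Finset.sum_comm]
  norm_num
  refine Finset.sum_congr rfl fun i hi ↦ ?_
  rw [hf i (by simpa using hi), Finset.univ_eq_attach]

theorem eq_fundamentalWeight_of_isMinusculeWeight [P.IsIrreducible] {u : b.support → ℤ}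
    (hu : 0 ≤ u) (hm : IsMinusculeWeight P (toWeight b u)) (h0 : u ≠ 0) :
    ∃ i, toWeight b u = fundamentalWeight b i := by
  classical
  obtain ⟨i, hi⟩ := Function.ne_iff.mp h0
  have : Nonempty ι := ⟨i⟩
  -- The flipped base gives a coroot with every coefficient at least 1; its pairing with the weight
  -- is at most 1, which bounds the sum of the coordinates by 1.
  obtain ⟨k, f, hf, hk⟩ := exists_root_full_support b.flip
  replace hk : P.coroot k = ∑ j : b.support, f j • P.coroot j := hk
  have hpair : P.toLinearMap (toWeight b u) (P.coroot k) =
      ((∑ j : b.support, f j * u j : ℤ) : ℝ) := by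
    rw [hk]
    simp [toWeight_coroot]
  have hle : ∑ j : b.support, (f j : ℤ) * u j ≤ 1 := by
    have := hm.2 k
    rw [hpair] at this
    simp only [mem_insert_iff, mem_singleton_iff] at this
    norm_cast at this
    lia
  have hle' : ∑ j : b.support, u j ≤ 1 := by
    refine (Finset.sum_le_sum fun j _ ↦ ?_).trans hle
    have h1 : (1 : ℤ) ≤ f j := by exact_mod_cast hf j
    have := hu j
    simp only [Pi.zero_apply] at this
    nlinarith
  have hi1 : 0 < u i := lt_of_le_of_ne (hu i) (Ne.symm hi)
  have hsplit := Finset.add_sum_erase Finset.univ u (Finset.mem_univ i)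
  have hsum : ∑ j ∈ Finset.univ.erase i, u j = 0 :=
    le_antisymm (by lia) (Finset.sum_nonneg fun j _ ↦ hu j)
  have hrest := (Finset.sum_eq_zero_iff_of_nonneg fun j _ ↦ hu j).mp hsum
  refine ⟨i, ext_of_coroot b fun j hj ↦ ?_⟩
  rw [toWeight_coroot b u ⟨j, hj⟩, fundamentalWeight_coroot b i ⟨j, hj⟩]
  split_ifs with hji
  · rw [hji]
    exact_mod_cast (by lia : u i = 1)
  · exact_mod_cast hrest ⟨j, hj⟩ (by simp [hji])

/-! ### Classification of superstable and recurrent configurations -/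

theorem image_toWeight_isSuperstable (b : P.Base) :
    toWeight b '' {u | ChipFiring.IsSuperstable b.cartanMatrix u} =
      minusculeDominantWeights b := by
  ext x
  constructor
  · rintro ⟨u, hu, rfl⟩
    exact ⟨isMinusculeWeight_of_isSuperstable hu, isDominantWeight_toWeight_iff.mpr hu.1⟩
  · rintro ⟨hm, hd⟩
    obtain ⟨u, rfl⟩ := exists_toWeight_eq (b := b) hm.1
    exact ⟨u, isSuperstable_of_isMinusculeWeight (isDominantWeight_toWeight_iff.mp hd) hm, rfl⟩

omit [P.IsRootSystem] [P.IsCrystallographic] [Fintype ι] [P.IsReduced] in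
theorem zero_mem_minusculeDominantWeights (b : P.Base) : 0 ∈ minusculeDominantWeights b :=
  have h : (0 : V) ∈ weightLattice P := fun _ ↦ ⟨0, by simp⟩
  ⟨⟨h, by simp⟩, h, by simp⟩

theorem isRecurrent_cartanMatrix_iff {v : b.support → ℤ} :
    ChipFiring.IsRecurrent b.cartanMatrix v ↔ ChipFiring.IsSuperstable b.cartanMatrix (1 - v) := by
  classical
  obtain ⟨y, hy, hy2⟩ := exists_transpose_cartanMatrix_mulVec_eq_two b
  have hinj : Injective (b.cartanMatrixᵀ *ᵥ ·) := by
    refine mulVec_injective_iff.mpr (linearIndependent_cols_of_det_ne_zero ?_)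
    rw [det_transpose]
    exact nondegenerate_iff_det_ne_zero.mp b.cartanMatrix_nondegenerate
  rw [ChipFiring.isRecurrent_iff_isSuperstable (isZMatrix_cartanMatrix b) (by simp) hinj hy
    (by simp [hy2])]
  congr! 2
  simp

end RootWeights

theorem theorem1p1 {ι V V' : Type*} [Fintype ι] [AddCommGroup V] [Module ℝ V]
    [AddCommGroup V'] [Module ℝ V'] (P : RootPairing ι ℝ V V')
    [P.IsRootSystem] [P.IsCrystallographic] [P.IsReduced] [P.IsIrreducible] (b : P.Base) :
    ChipFiring.IsAvalancheFinite b.cartanMatrix ∧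
    -- superstable configurations
    RootWeights.toWeight b '' {u | ChipFiring.IsSuperstable b.cartanMatrix u} =
      {0} ∪ RootWeights.minusculeDominantWeights b ∧
    -- the Weyl vector and the recurrent configurations
    RootWeights.toWeight b 1 = RootWeights.weylVector b ∧
    RootWeights.toWeight b '' {v | ChipFiring.IsRecurrent b.cartanMatrix v} =
      {RootWeights.weylVector b} ∪
        {x | ∃ y ∈ RootWeights.minusculeDominantWeights b, x = RootWeights.weylVector b - y} ∧
    -- the nonzero minuscule dominant weights are fundamental weights
    ∀ y ∈ RootWeights.minusculeDominantWeights b, y ≠ 0 →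
      ∃ i : b.support, y = RootWeights.fundamentalWeight b i := by
  classical
  obtain ⟨z, hz, hz2⟩ := RootWeights.exists_transpose_cartanMatrix_mulVec_eq_two b
  have hzero := RootWeights.zero_mem_minusculeDominantWeights b
  have hsuper := RootWeights.image_toWeight_isSuperstable b
  refine ⟨ChipFiring.isAvalancheFinite_of_script (RootWeights.isZMatrix_cartanMatrix b) (by simp)
    hz (by simp [hz2]), ?_, RootWeights.toWeight_one, ?_, ?_⟩
  -- The zero weight is minuscule dominant, so `ϱ = ϱ - 0` is already in the second set.
  · rw [hsuper, Set.singleton_union, Set.insert_eq_of_mem hzero]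
  · rw [Set.singleton_union, Set.insert_eq_of_mem (Set.mem_ofPred_eq ▸ ⟨0, hzero, by simp⟩), ← hsuper]
    ext x
    constructor
    · rintro ⟨v, hv, rfl⟩
      refine ⟨_, ⟨1 - v, RootWeights.isRecurrent_cartanMatrix_iff.mp hv, rfl⟩, ?_⟩
      rw [RootWeights.toWeight_sub, RootWeights.toWeight_one, sub_sub_cancel]
    · rintro ⟨_, ⟨u, hu, rfl⟩, rfl⟩
      refine ⟨1 - u, RootWeights.isRecurrent_cartanMatrix_iff.mpr (by simpa using hu), ?_⟩
      rw [RootWeights.toWeight_sub, RootWeights.toWeight_one]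
  · rintro y ⟨hm, hd⟩ hy0
    obtain ⟨u, rfl⟩ := RootWeights.exists_toWeight_eq (b := b) hm.1
    refine RootWeights.eq_fundamentalWeight_of_isMinusculeWeight
      (RootWeights.isDominantWeight_toWeight_iff.mp hd) hm ?_
    rintro rfl
    exact hy0 (by simp [RootWeights.toWeight])
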